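/- There exist absolute constants $c, C_1, C_2 > 0$ such that the following holds. Let $d \ge 1$, let $G=(V,E)$ be a finite simple $d$-regular graph on $n \ge 1$ vertices, and let $k$ be a real number with $k \ge c\log^9 n$, where $\log = \log_2$. For $J \subseteq V$, the edge density of the induced subgraph $G[J]$ is $|E(G[J])| / \binom{|J|}{2}$ (taken to be $0$ when $|J| \le 1$). Then the number of subsets $J \subseteq V$ such that $G[J]$ has edge density at most $\frac{1}{k}\cdot\frac{d}{n}$ is at most $$2^{\frac{n}{2}\left(1 + C_1\frac{\log^3 n}{d} + C_2\frac{\log^3 n}{k^{1/3}}\right)}.$$ -/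

import Mathlib

/-- Edge density of the subgraph `G[J]` induced by the vertex set `J`: the number of edges of `G`
with both endpoints in `J`, divided by `|J| choose 2`. If `|J| ≤ 1` there are no edges and the
value is `0`. -/
noncomputable def inducedDensity {V : Type*} (G : SimpleGraph V) (J : Finset V) : ℝ :=
  ((G.induce (J : Set V)).edgeSet.ncard : ℝ) / ((J.card.choose 2 : ℕ) : ℝ)

/-!
Delete from a sparse set `J` its vertices of induced degree above `t = d / k^(2/3)`: by counting
edges there are at most `n / k^(1/3)` of them, which contributes a factor `n^O(n / k^(1/3))`, and
what remains is `t`-bounded, i.e. induces a subgraph of maximum degree at most `t`.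

To count `t`-bounded sets we follow the argument for independent sets. Zhao's swapping trick turns
a pair of `t`-bounded sets injectively into a pair `(A, B)` in which every vertex of `B` has at
most `2t` neighbours in `A`. For fixed `A` the number of such `B` is a product over the vertices
`v` of a function of `A ∩ N(v)`; since every vertex lies in exactly `d` neighbourhoods, Finner's
inequality bounds the sum over `A` by a product of local sums over the subsets of `N(v)`, each of
them at most `2^(d+1) (d+1)^(2t)`.
-/

open Finset
open scoped symmDiff

section Holder

variable {ι α : Type*}

theorem prod_rpow_add_prod_rpow_le_prod_add_rpow {s : Finset ι} {w p q : ι → ℝ}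
    (hw : ∀ i ∈ s, 0 ≤ w i) (hw₁ : ∑ i ∈ s, w i = 1)
    (hp : ∀ i ∈ s, 0 ≤ p i) (hq : ∀ i ∈ s, 0 ≤ q i) :
    ∏ i ∈ s, p i ^ w i + ∏ i ∈ s, q i ^ w i ≤ ∏ i ∈ s, (p i + q i) ^ w i := by
  have hpq : ∀ i ∈ s, 0 ≤ p i + q i := fun i hi => add_nonneg (hp i hi) (hq i hi)
  have amgm : ∀ r : ι → ℝ, (∀ i ∈ s, 0 ≤ r i) → (∀ i ∈ s, p i + q i = 0 → r i = 0) →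
      ∏ i ∈ s, r i ^ w i ≤
        (∏ i ∈ s, (p i + q i) ^ w i) * ∑ i ∈ s, w i * (r i / (p i + q i)) := by
    intro r hr hr₀
    calc ∏ i ∈ s, r i ^ w i
        = ∏ i ∈ s, (p i + q i) ^ w i * (r i / (p i + q i)) ^ w i :=
          prod_congr rfl fun i hi => by
            rw [← Real.mul_rpow (hpq i hi) (div_nonneg (hr i hi) (hpq i hi)),
              mul_div_cancel_of_imp' (hr₀ i hi)]
      _ = (∏ i ∈ s, (p i + q i) ^ w i) * ∏ i ∈ s, (r i / (p i + q i)) ^ w i :=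
          prod_mul_distrib
      _ ≤ _ := mul_le_mul_of_nonneg_left
          (Real.geom_mean_le_arith_mean_weighted s _ _ hw hw₁
            fun i hi => div_nonneg (hr i hi) (hpq i hi))
          (prod_nonneg fun i hi => Real.rpow_nonneg (hpq i hi) _)
  have weights_le :
      ∑ i ∈ s, w i * (p i / (p i + q i)) + ∑ i ∈ s, w i * (q i / (p i + q i)) ≤ 1 := by
    rw [← sum_add_distrib, ← hw₁]
    refine sum_le_sum fun i hi => ?_
    rw [← mul_add, ← add_div]
    exact mul_le_of_le_one_right (hw i hi) (div_self_le_one _)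
  calc ∏ i ∈ s, p i ^ w i + ∏ i ∈ s, q i ^ w i
      ≤ (∏ i ∈ s, (p i + q i) ^ w i) *
          (∑ i ∈ s, w i * (p i / (p i + q i)) + ∑ i ∈ s, w i * (q i / (p i + q i))) := by
        rw [mul_add]
        exact add_le_add
          (amgm p hp fun i hi h => by linarith [hp i hi, hq i hi])
          (amgm q hq fun i hi h => by linarith [hp i hi, hq i hi])
    _ ≤ ∏ i ∈ s, (p i + q i) ^ w i :=
        mul_le_of_le_one_right (prod_nonneg fun i hi => Real.rpow_nonneg (hpq i hi) _) weights_le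

theorem prod_rpow_add_prod_rpow_le_prod_ite_rpow {s : Finset ι} {t : ι → Prop} [DecidablePred t]
    {w p q : ι → ℝ} (hw : ∀ i ∈ s, 0 ≤ w i) (hw₁ : ∑ i ∈ s with t i, w i = 1)
    (hp : ∀ i ∈ s, 0 ≤ p i) (hq : ∀ i ∈ s, 0 ≤ q i) (hpq : ∀ i ∈ s, ¬ t i → q i = p i) :
    ∏ i ∈ s, p i ^ w i + ∏ i ∈ s, q i ^ w i ≤
      ∏ i ∈ s, (if t i then p i + q i else p i) ^ w i := by
  have hq_out : ∏ i ∈ s with ¬ t i, q i ^ w i = ∏ i ∈ s with ¬ t i, p i ^ w i :=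
    prod_congr rfl fun i hi => by rw [hpq i (mem_filter.mp hi).1 (mem_filter.mp hi).2]
  calc ∏ i ∈ s, p i ^ w i + ∏ i ∈ s, q i ^ w i
      = (∏ i ∈ s with t i, p i ^ w i + ∏ i ∈ s with t i, q i ^ w i) *
          ∏ i ∈ s with ¬ t i, p i ^ w i := by
        rw [← prod_filter_mul_prod_filter_not s t fun i => p i ^ w i,
          ← prod_filter_mul_prod_filter_not s t fun i => q i ^ w i, hq_out, add_mul]
    _ ≤ (∏ i ∈ s with t i, (p i + q i) ^ w i) * ∏ i ∈ s with ¬ t i, p i ^ w i := by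
        refine mul_le_mul_of_nonneg_right ?_ (prod_nonneg fun i hi =>
          Real.rpow_nonneg (hp i (mem_filter.mp hi).1) _)
        exact prod_rpow_add_prod_rpow_le_prod_add_rpow (fun i hi => hw i (mem_filter.mp hi).1) hw₁
          (fun i hi => hp i (mem_filter.mp hi).1) fun i hi => hq i (mem_filter.mp hi).1
    _ = ∏ i ∈ s, (if t i then p i + q i else p i) ^ w i := by simp only [ite_pow, prod_ite]

/-- Finner's extension of Hölder's inequality, for functions on the cube of subsets of `S`. -/
theorem sum_powerset_prod_rpow_le_prod_sum_rpow [Fintype ι] [DecidableEq α]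
    {N : ι → Finset α} {w : ι → ℝ} (hw : ∀ i, 0 ≤ w i) {S : Finset α}
    (hN : ∀ x ∈ S, ∑ i with x ∈ N i, w i = 1) {f : ι → Finset α → ℝ} (hf : ∀ i a, 0 ≤ f i a) :
    ∑ A ∈ S.powerset, ∏ i, f i (A ∩ N i) ^ w i ≤
      ∏ i, (∑ a ∈ (S ∩ N i).powerset, f i a) ^ w i := by
  induction S using Finset.induction_on generalizing f with
  | empty => simp
  | insert x S hxS ih =>
    let f' : ι → Finset α → ℝ := fun i a => if x ∈ N i then f i (insert x a) else f i a
    let P : ι → ℝ := fun i => ∑ a ∈ (S ∩ N i).powerset, f i a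
    let Q : ι → ℝ := fun i => ∑ a ∈ (S ∩ N i).powerset, f' i a
    have hf' : ∀ i a, 0 ≤ f' i a := fun i a => by dsimp only [f']; split_ifs <;> exact hf _ _
    have hNS : ∀ y ∈ S, ∑ i with y ∈ N i, w i = 1 := fun y hy => hN y (mem_insert_of_mem hy)
    have f_insert : ∀ A i, f i (insert x A ∩ N i) = f' i (A ∩ N i) := fun A i => by
      by_cases hx : x ∈ N i <;> simp [f', hx, insert_inter_of_mem, insert_inter_of_notMem]
    have sum_insert : ∀ i, ∑ a ∈ (insert x S ∩ N i).powerset, f i a =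
        if x ∈ N i then P i + Q i else P i := fun i => by
      split_ifs with hx
      · rw [insert_inter_of_mem hx, sum_powerset_insert fun h => hxS (mem_inter.mp h).1]
        simp [P, Q, f', hx]
      · rw [insert_inter_of_notMem hx]
    calc ∑ A ∈ (insert x S).powerset, ∏ i, f i (A ∩ N i) ^ w i
        = ∑ A ∈ S.powerset, ∏ i, f i (A ∩ N i) ^ w i +
            ∑ A ∈ S.powerset, ∏ i, f' i (A ∩ N i) ^ w i := by
          simp only [sum_powerset_insert hxS, f_insert]
      _ ≤ ∏ i, P i ^ w i + ∏ i, Q i ^ w i := add_le_add (ih hNS hf) (ih hNS hf')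
      _ ≤ ∏ i, (if x ∈ N i then P i + Q i else P i) ^ w i :=
          prod_rpow_add_prod_rpow_le_prod_ite_rpow (fun i _ => hw i)
            (hN x (mem_insert_self x S)) (fun i _ => sum_nonneg fun a _ => hf i a)
            (fun i _ => sum_nonneg fun a _ => hf' i a) fun i _ hx => by simp [P, Q, f', hx]
      _ = ∏ i, (∑ a ∈ (insert x S ∩ N i).powerset, f i a) ^ w i := by simp only [sum_insert]

end Holder

theorem card_filter_powerset_card_le {α : Type*} (X : Finset α) (s : ℕ) :
    #{a ∈ X.powerset | #a ≤ s} ≤ (#X + 1) ^ s := by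
  classical
  have by_size : {a ∈ X.powerset | #a ≤ s} = (range (s + 1)).biUnion X.powersetCard := by
    ext a
    simp only [mem_filter, mem_powerset, mem_biUnion, mem_range, mem_powersetCard,
      Nat.lt_succ_iff]
    exact ⟨fun ⟨haX, ha⟩ => ⟨_, ha, haX, rfl⟩, fun ⟨_, hi, haX, ha⟩ => ⟨haX, ha ▸ hi⟩⟩
  calc #{a ∈ X.powerset | #a ≤ s}
      ≤ ∑ i ∈ range (s + 1), #(X.powersetCard i) := by_size ▸ card_biUnion_le
    _ ≤ ∑ i ∈ range (s + 1), #X ^ i * 1 ^ (s - i) * s.choose i := sum_le_sum fun i hi => by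
        rw [card_powersetCard, one_pow, mul_one]
        exact (Nat.choose_le_pow _ _).trans
          (Nat.le_mul_of_pos_right _ (Nat.choose_pos (mem_range_succ_iff.mp hi)))
    _ = (#X + 1) ^ s := (add_pow _ _ _).symm

theorem sum_powerset_ite_card_le {α : Type*} (X : Finset α) (s : ℕ) :
    ∑ a ∈ X.powerset, (if #a ≤ s then (2 : ℝ) ^ #X else 1) ≤
      2 ^ (#X + 1) * ((#X : ℝ) + 1) ^ s := by
  have few_small : (#{a ∈ X.powerset | #a ≤ s} : ℝ) ≤ ((#X : ℝ) + 1) ^ s := by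
    exact_mod_cast card_filter_powerset_card_le X s
  have one_le : (1 : ℝ) ≤ ((#X : ℝ) + 1) ^ s := one_le_pow₀ (by simp)
  calc ∑ a ∈ X.powerset, (if #a ≤ s then (2 : ℝ) ^ #X else 1)
      ≤ ∑ a ∈ X.powerset, ((if #a ≤ s then (2 : ℝ) ^ #X else 0) + 1) :=
        sum_le_sum fun a _ => by split_ifs <;> simp
    _ = #{a ∈ X.powerset | #a ≤ s} * (2 : ℝ) ^ #X + 2 ^ #X := by
        simp [sum_add_distrib, ← sum_filter]
    _ ≤ ((#X : ℝ) + 1) ^ s * 2 ^ #X + ((#X : ℝ) + 1) ^ s * 2 ^ #X := by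
        gcongr
        exact le_mul_of_one_le_left (by positivity) one_le
    _ = 2 ^ (#X + 1) * ((#X : ℝ) + 1) ^ s := by ring

theorem add_one_pow_floor_le_two_rpow {x y : ℝ} (hx : 2 ≤ x) (hy : 0 ≤ y) :
    (x + 1) ^ ⌊y⌋₊ ≤ 2 ^ (2 * Real.logb 2 x * y) := by
  calc (x + 1) ^ ⌊y⌋₊ ≤ (x + 1) ^ y := by
        rw [← Real.rpow_natCast]
        exact Real.rpow_le_rpow_of_exponent_le (by linarith) (Nat.floor_le hy)
    _ ≤ (x ^ (2 : ℝ)) ^ y := by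
        gcongr
        rw [Real.rpow_two]
        nlinarith
    _ = (((2 : ℝ) ^ Real.logb 2 x) ^ (2 : ℝ)) ^ y := by
        rw [Real.rpow_logb two_pos (by norm_num) (by linarith)]
    _ = 2 ^ (2 * Real.logb 2 x * y) := by
        rw [← Real.rpow_mul two_pos.le, ← Real.rpow_mul two_pos.le, mul_comm (Real.logb 2 x)]

theorem symmDiff_swap_injective {β : Type*} [BooleanAlgebra β] (W : β → β) :
    Function.Injective fun P : β × β => (P.1 ∆ W (P.1 ∆ P.2), P.2 ∆ W (P.1 ∆ P.2)) := by
  rintro ⟨A, B⟩ ⟨A', B'⟩ h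
  obtain ⟨h₁, h₂⟩ := Prod.mk.inj h
  have same_symmDiff : A ∆ B = A' ∆ B' := by
    simpa only [symmDiff_symmDiff_symmDiff_comm, symmDiff_self, symmDiff_bot] using
      congrArg₂ (· ∆ ·) h₁ h₂
  rw [same_symmDiff] at h₁ h₂
  exact Prod.ext (symmDiff_left_injective _ h₁) (symmDiff_left_injective _ h₂)

section Graph

variable {V : Type*} [DecidableEq V] (G : SimpleGraph V) [G.LocallyFinite]

/-- The number of neighbours in `A` of a vertex `v`, which need not belong to `A`. -/
def degreeIn (A : Finset V) (v : V) : ℕ :=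
  #(A ∩ G.neighborFinset v)

/-- The induced subgraph `G[A]` has maximum degree at most `t`. -/
def IsDegreeBounded (t : ℕ) (A : Finset V) : Prop :=
  ∀ v ∈ A, degreeIn G A v ≤ t

instance (t : ℕ) : DecidablePred (IsDegreeBounded G t) := fun A =>
  inferInstanceAs (Decidable (∀ v ∈ A, degreeIn G A v ≤ t))

variable {G}

theorem degreeIn_mono {A B : Finset V} (h : A ⊆ B) (v : V) : degreeIn G A v ≤ degreeIn G B v :=
  card_le_card (inter_subset_inter_right h)

theorem degreeIn_union_le (A B : Finset V) (v : V) :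
    degreeIn G (A ∪ B) v ≤ degreeIn G A v + degreeIn G B v := by
  simpa only [degreeIn, union_inter_distrib_right] using card_union_le _ _

theorem sum_degreeIn_eq_twice_ncard_edgeSet_induce (J : Finset V) :
    ∑ v ∈ J, degreeIn G J v = 2 * (G.induce (J : Set V)).edgeSet.ncard := by
  classical
  rw [Set.ncard_eq_toFinset_card', ← SimpleGraph.edgeFinset,
    ← (G.induce (J : Set V)).sum_degrees_eq_twice_card_edges, ← sum_coe_sort]
  refine sum_congr rfl fun v _ => ?_
  rw [degreeIn, ← SimpleGraph.card_neighborFinset_eq_degree, ← card_map (.subtype (· ∈ J))]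
  congr 1
  ext w
  simp [and_comm]

theorem card_filter_lt_degreeIn_le {J : Finset V} {x y : ℝ} (hx : 0 < x)
    (hJ : 2 * ((G.induce (J : Set V)).edgeSet.ncard : ℝ) ≤ x * y) :
    #{v ∈ J | ⌊x⌋₊ < degreeIn G J v} ≤ ⌊y⌋₊ := by
  refine Nat.le_floor (le_of_mul_le_mul_left ?_ hx)
  calc x * #{v ∈ J | ⌊x⌋₊ < degreeIn G J v}
      ≤ ∑ v ∈ J with ⌊x⌋₊ < degreeIn G J v, (degreeIn G J v : ℝ) := by
        rw [mul_comm, ← nsmul_eq_mul]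
        exact card_nsmul_le_sum _ _ _ fun v hv =>
          ((Nat.floor_lt hx.le).mp (mem_filter.mp hv).2).le
    _ ≤ ∑ v ∈ J, (degreeIn G J v : ℝ) :=
        sum_le_sum_of_subset_of_nonneg (filter_subset _ _) fun _ _ _ => Nat.cast_nonneg _
    _ = 2 * ((G.induce (J : Set V)).edgeSet.ncard : ℝ) := by
        exact_mod_cast sum_degreeIn_eq_twice_ncard_edgeSet_induce J
    _ ≤ x * y := hJ

namespace IsDegreeBounded

variable {t : ℕ} {A B : Finset V}

theorem mono (hA : IsDegreeBounded G t A) (h : B ⊆ A) : IsDegreeBounded G t B := fun v hv =>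
  (degreeIn_mono h v).trans (hA v (h hv))

theorem degreeIn_le_two_mul_of_subset_union {C : Finset V} {v : V} (hA : IsDegreeBounded G t A)
    (hB : IsDegreeBounded G t B) (hvA : v ∈ A) (hvB : v ∈ B) (hC : C ⊆ A ∪ B) :
    degreeIn G C v ≤ 2 * t := by
  have := (degreeIn_mono (G := G) hC v).trans (degreeIn_union_le A B v)
  linarith [hA v hvA, hB v hvB]

theorem degreeIn_symmDiff_le_two_mul {W : Finset V} {v : V} (hA : IsDegreeBounded G t A)
    (hB : IsDegreeBounded G t B) (hWAB : W ⊆ A ∆ B) (hW : IsDegreeBounded G t W)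
    (hW' : IsDegreeBounded G t (A ∆ B \ W)) (hv : v ∈ B ∆ W) :
    degreeIn G (A ∆ W) v ≤ 2 * t := by
  by_cases hvA : v ∈ A
  · by_cases hvB : v ∈ B
    · refine hA.degreeIn_le_two_mul_of_subset_union hB hvA hvB ?_
      grind [mem_symmDiff]
    · refine hA.degreeIn_le_two_mul_of_subset_union hW hvA ?_ ?_ <;> grind [mem_symmDiff]
  · refine hB.degreeIn_le_two_mul_of_subset_union hW' ?_ ?_ ?_ <;> grind [mem_symmDiff]

end IsDegreeBounded

variable (G) in
theorem exists_isDegreeBounded_split (t : ℕ) :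
    ∃ W : Finset V → Finset V, ∀ A B, IsDegreeBounded G t A → IsDegreeBounded G t B →
      W (A ∆ B) ⊆ A ∆ B ∧ IsDegreeBounded G t (W (A ∆ B)) ∧
        IsDegreeBounded G t (A ∆ B \ W (A ∆ B)) := by
  have split_symmDiff : ∀ U, ∃ W, ∀ A B, IsDegreeBounded G t A → IsDegreeBounded G t B →
      A ∆ B = U → W ⊆ U ∧ IsDegreeBounded G t W ∧ IsDegreeBounded G t (U \ W) := by
    intro U
    by_cases hU : ∃ A B, IsDegreeBounded G t A ∧ IsDegreeBounded G t B ∧ A ∆ B = U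
    · obtain ⟨A, B, hA, hB, rfl⟩ := hU
      exact ⟨A \ B, fun _ _ _ _ _ => ⟨le_sup_left, hA.mono sdiff_subset,
        hB.mono (by grind [mem_symmDiff])⟩⟩
    · exact ⟨∅, fun A B hA hB h => absurd ⟨A, B, hA, hB, h⟩ hU⟩
  choose W hW using split_symmDiff
  exact ⟨W, fun A B hA hB => hW _ A B hA hB rfl⟩

variable [Fintype V]

variable (G) in
/-- Zhao's swapping trick: `A` and `B` trade their vertices in a part `W` of `A ∆ B`. As `W` depends
only on `A ∆ B`, which the trade preserves, the trade can be undone. -/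
theorem sq_card_isDegreeBounded_le (t : ℕ) :
    #{A : Finset V | IsDegreeBounded G t A} ^ 2 ≤
      #{P : Finset V × Finset V | ∀ v ∈ P.2, degreeIn G P.1 v ≤ 2 * t} := by
  obtain ⟨W, hW⟩ := exists_isDegreeBounded_split G t
  rw [sq, ← card_product]
  refine card_le_card_of_injOn _ ?_ (symmDiff_swap_injective W).injOn
  rintro ⟨A, B⟩ hAB
  simp only [coe_product, coe_filter, mem_univ, true_and, Set.mem_prod, Set.mem_ofPred_eq] at hAB ⊢
  obtain ⟨hA, hB⟩ := hAB
  obtain ⟨hWAB, hW₁, hW₂⟩ := hW A B hA hB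
  exact fun v => hA.degreeIn_symmDiff_le_two_mul hB hWAB hW₁ hW₂

variable (G) in
theorem card_filter_forall_degreeIn_le_eq_sum_prod (s : ℕ) :
    #{P : Finset V × Finset V | ∀ v ∈ P.2, degreeIn G P.1 v ≤ s} =
      ∑ A : Finset V, ∏ v, if degreeIn G A v ≤ s then 2 else 1 := by
  rw [card_filter, ← univ_product_univ, sum_product]
  refine sum_congr rfl fun A _ => ?_
  have second_coordinate :
      ({B | ∀ v ∈ B, degreeIn G A v ≤ s} : Finset (Finset V)) =
        ({v | degreeIn G A v ≤ s} : Finset V).powerset := by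
    ext B
    simp [subset_iff]
  rw [← card_filter, second_coordinate, card_powerset, prod_ite, prod_const, prod_const_one,
    mul_one]

section Regular

variable {d : ℕ}

theorem card_filter_forall_degreeIn_le (hd : 1 ≤ d) (hG : G.IsRegularOfDegree d) (s : ℕ) :
    (#{P : Finset V × Finset V | ∀ v ∈ P.2, degreeIn G P.1 v ≤ s} : ℝ) ≤
      (((2 : ℝ) ^ (d + 1) * ((d : ℝ) + 1) ^ s) ^ (1 / (d : ℝ))) ^ Fintype.card V := by
  let f : Finset V → ℝ := fun a => if #a ≤ s then 2 ^ d else 1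
  have hf : ∀ a, 0 ≤ f a := fun a => by dsimp only [f]; positivity
  have hd₀ : d ≠ 0 := by omega
  have f_rpow : ∀ A v, f (A ∩ G.neighborFinset v) ^ (1 / (d : ℝ)) =
      if degreeIn G A v ≤ s then 2 else 1 := fun A v => by
    change (if degreeIn G A v ≤ s then (2 : ℝ) ^ d else 1) ^ (1 / (d : ℝ)) = _
    split_ifs
    · rw [one_div, Real.pow_rpow_inv_natCast two_pos.le hd₀]
    · exact Real.one_rpow _
  have cover : ∀ x : V, ∑ v with x ∈ G.neighborFinset v, 1 / (d : ℝ) = 1 := fun x => by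
    have : ({v | x ∈ G.neighborFinset v} : Finset V) = G.neighborFinset x := by
      ext v; simp [G.adj_comm]
    rw [this, sum_const, G.card_neighborFinset_eq_degree, hG x, nsmul_eq_mul]
    field_simp
  calc (#{P : Finset V × Finset V | ∀ v ∈ P.2, degreeIn G P.1 v ≤ s} : ℝ)
      = ∑ A ∈ (univ : Finset V).powerset, ∏ v, f (A ∩ G.neighborFinset v) ^ (1 / (d : ℝ)) := by
        rw [card_filter_forall_degreeIn_le_eq_sum_prod]
        simp only [f_rpow, powerset_univ, Nat.cast_sum, Nat.cast_prod, Nat.cast_ite,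
          Nat.cast_ofNat, Nat.cast_one]
    _ ≤ ∏ v, (∑ a ∈ (univ ∩ G.neighborFinset v).powerset, f a) ^ (1 / (d : ℝ)) :=
        sum_powerset_prod_rpow_le_prod_sum_rpow (fun _ => by positivity) (fun x _ => cover x)
          fun _ => hf
    _ ≤ ∏ _v : V, ((2 : ℝ) ^ (d + 1) * ((d : ℝ) + 1) ^ s) ^ (1 / (d : ℝ)) := by
        gcongr with v
        simpa only [univ_inter, G.card_neighborFinset_eq_degree, hG v] using
          sum_powerset_ite_card_le (G.neighborFinset v) s
    _ = _ := by rw [prod_const, card_univ]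

theorem card_isDegreeBounded_le_two_rpow (hd : 1 ≤ d) (hG : G.IsRegularOfDegree d) (t : ℕ) :
    (#{A : Finset V | IsDegreeBounded G t A} : ℝ) ≤
      2 ^ ((Fintype.card V : ℝ) / 2 * (1 + 1 / d + 2 * t * Real.logb 2 (d + 1) / d)) := by
  have base_eq : (2 : ℝ) ^ (d + 1) * ((d : ℝ) + 1) ^ (2 * t) =
      2 ^ ((d : ℝ) + 1 + 2 * t * Real.logb 2 (d + 1)) := by
    rw [Real.rpow_add two_pos, mul_comm (2 * (t : ℝ)), Real.rpow_mul two_pos.le,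
      Real.rpow_logb two_pos (by norm_num) (by positivity)]
    norm_cast
  refine (pow_le_pow_iff_left₀ (Nat.cast_nonneg _) (by positivity) two_ne_zero).mp ?_
  calc (#{A : Finset V | IsDegreeBounded G t A} : ℝ) ^ 2
      ≤ #{P : Finset V × Finset V | ∀ v ∈ P.2, degreeIn G P.1 v ≤ 2 * t} := by
        exact_mod_cast sq_card_isDegreeBounded_le G t
    _ ≤ (((2 : ℝ) ^ (d + 1) * ((d : ℝ) + 1) ^ (2 * t)) ^ (1 / (d : ℝ))) ^ Fintype.card V :=
        card_filter_forall_degreeIn_le hd hG (2 * t)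
    _ = _ := by
        rw [base_eq, ← Real.rpow_mul two_pos.le, ← Real.rpow_mul_natCast two_pos.le,
          ← Real.rpow_mul_natCast two_pos.le]
        congr 1
        push_cast
        field_simp

end Regular

theorem card_le_card_isDegreeBounded_mul {t m : ℕ} {F : Finset (Finset V)}
    (hF : ∀ J ∈ F, #{v ∈ J | t < degreeIn G J v} ≤ m) :
    #F ≤ #{A : Finset V | IsDegreeBounded G t A} * (Fintype.card V + 1) ^ m := by
  calc #F
      ≤ #(({A | IsDegreeBounded G t A} : Finset (Finset V)) ×ˢ
          {R ∈ (univ : Finset V).powerset | #R ≤ m}) := by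
        refine card_le_card_of_injOn
          (fun J => ({v ∈ J | ¬ t < degreeIn G J v}, {v ∈ J | t < degreeIn G J v})) ?_ ?_
        · intro J hJ
          refine mem_product.mpr ⟨?_, ?_⟩
          · refine mem_filter.mpr ⟨mem_univ _, fun v hv => ?_⟩
            exact (degreeIn_mono (filter_subset _ J) v).trans (not_lt.mp (mem_filter.mp hv).2)
          · exact mem_filter.mpr ⟨mem_powerset.mpr (subset_univ _), hF J hJ⟩
        · intro J _ J' _ h
          obtain ⟨h_low, h_high⟩ := Prod.mk.inj h
          rw [← filter_union_filter_not_eq (t < degreeIn G J ·) J, h_low, h_high,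
            filter_union_filter_not_eq]
    _ = #{A : Finset V | IsDegreeBounded G t A} *
          #{R ∈ (univ : Finset V).powerset | #R ≤ m} := card_product _ _
    _ ≤ _ := Nat.mul_le_mul_left _ (card_filter_powerset_card_le univ m)

end Graph

section Density

variable {V : Type*} {G : SimpleGraph V}

theorem ncard_edgeSet_induce_le_choose_two (J : Finset V) :
    (G.induce (J : Set V)).edgeSet.ncard ≤ (#J).choose 2 := by
  classical
  rw [Set.ncard_eq_toFinset_card', ← SimpleGraph.edgeFinset]
  simpa using (G.induce (J : Set V)).card_edgeFinset_le_card_choose_two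

theorem inducedDensity_mul_choose_two (J : Finset V) :
    inducedDensity G J * (#J).choose 2 = (G.induce (J : Set V)).edgeSet.ncard := by
  refine div_mul_cancel_of_imp fun h => ?_
  have := ncard_edgeSet_induce_le_choose_two (G := G) J
  norm_cast at h ⊢
  omega

theorem two_mul_ncard_edgeSet_induce_le [Fintype V] {J : Finset V} {x : ℝ}
    (hJ : inducedDensity G J ≤ x) :
    2 * ((G.induce (J : Set V)).edgeSet.ncard : ℝ) ≤ x * (Fintype.card V : ℝ) ^ 2 := by
  have hx : 0 ≤ x := (div_nonneg (Nat.cast_nonneg _) (Nat.cast_nonneg _)).trans hJ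
  have choose_le : 2 * ((#J).choose 2 : ℝ) ≤ (Fintype.card V : ℝ) ^ 2 := by
    have : (#J : ℝ) ≤ Fintype.card V := by exact_mod_cast card_le_univ J
    rw [Nat.cast_choose_two]
    nlinarith [(#J).cast_nonneg (α := ℝ)]
  calc 2 * ((G.induce (J : Set V)).edgeSet.ncard : ℝ)
      = inducedDensity G J * (2 * (#J).choose 2) := by
        rw [← inducedDensity_mul_choose_two]; ring
    _ ≤ x * (Fintype.card V : ℝ) ^ 2 := by gcongr

end Density

section Regular

variable {V : Type*} [Fintype V] [Nonempty V] {G : SimpleGraph V} [G.LocallyFinite] {d : ℕ}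

theorem degree_lt_card (hG : G.IsRegularOfDegree d) :
    d < Fintype.card V := by
  classical
  obtain ⟨v⟩ := ‹Nonempty V›
  rw [← hG v, ← G.card_neighborFinset_eq_degree]
  exact card_lt_univ_of_notMem (x := v) (by simp)

theorem one_le_logb_card (hd : 1 ≤ d) (hG : G.IsRegularOfDegree d) :
    1 ≤ Real.logb 2 (Fintype.card V) := by
  have : 2 ≤ Fintype.card V := by have := degree_lt_card hG; omega
  rw [Real.le_logb_iff_rpow_le one_lt_two (by positivity), Real.rpow_one]
  exact_mod_cast this

theorem ncard_setOf_ncard_edgeSet_induce_le (hd : 1 ≤ d)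
    (hG : G.IsRegularOfDegree d) {κ : ℝ} (hκ : 0 < κ) :
    ({J : Finset V | 2 * ((G.induce (J : Set V)).edgeSet.ncard : ℝ) ≤
        d * Fintype.card V / κ ^ 3}.ncard : ℝ) ≤
      2 ^ ((Fintype.card V : ℝ) / 2 * (1 + 1 / d + 2 * (Real.logb 2 (Fintype.card V) / κ ^ 2) +
        4 * (Real.logb 2 (Fintype.card V) / κ))) := by
  classical
  set n := Fintype.card V
  set L := Real.logb 2 n
  have hdn : d + 1 ≤ n := degree_lt_card hG
  have hd₀ : (0 : ℝ) < d := by exact_mod_cast hd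
  have log_le : Real.logb 2 (d + 1) ≤ L :=
    Real.logb_le_logb_of_le one_lt_two (by positivity) (by exact_mod_cast hdn)
  have split_count := card_le_card_isDegreeBounded_mul (G := G) (t := ⌊d / κ ^ 2⌋₊)
    (m := ⌊n / κ⌋₊)
    (F := {J | 2 * ((G.induce (J : Set V)).edgeSet.ncard : ℝ) ≤ d * n / κ ^ 3}) fun J hJ =>
      card_filter_lt_degreeIn_le (by positivity) <|
        (mem_filter.mp hJ).2.trans_eq (by field_simp)
  rw [Set.ncard_eq_toFinset_card', Set.toFinset_ofPred]
  calc _ ≤ (#{A : Finset V | IsDegreeBounded G ⌊d / κ ^ 2⌋₊ A} : ℝ) * ((n : ℝ) + 1) ^ ⌊n / κ⌋₊ := by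
        exact_mod_cast split_count
    _ ≤ 2 ^ ((n : ℝ) / 2 * (1 + 1 / d + 2 * ⌊d / κ ^ 2⌋₊ * Real.logb 2 (d + 1) / d)) *
          2 ^ (2 * L * (n / κ)) := by
        gcongr
        · exact card_isDegreeBounded_le_two_rpow hd hG _
        · exact add_one_pow_floor_le_two_rpow (by exact_mod_cast (by omega : 2 ≤ n)) (by positivity)
    _ ≤ 2 ^ ((n : ℝ) / 2 * (1 + 1 / d + 2 * (d / κ ^ 2) * L / d)) * 2 ^ (2 * L * (n / κ)) := by
        gcongr
        · exact one_le_two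
        · exact Real.logb_nonneg one_lt_two (by linarith)
        · exact Nat.floor_le (by positivity)
    _ = _ := by
        rw [← Real.rpow_add two_pos]
        congr 1
        field_simp
        ring

end Regular

theorem theorem3_general {V : Type*} [Fintype V] [Nonempty V] {G : SimpleGraph V}
    [G.LocallyFinite] {d : ℕ} {k : ℝ} (hd : 1 ≤ d) (hG : G.IsRegularOfDegree d) (hk : 0 < k) :
    ({J : Finset V | inducedDensity G J ≤ (1 / k) * ((d : ℝ) / (Fintype.card V : ℝ))}.ncard : ℝ) ≤
      2 ^ ((Fintype.card V : ℝ) / 2 *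
        (1 + 1 / d + 6 * (Real.logb 2 (Fintype.card V) / k ^ ((1 : ℝ) / 3)))) := by
  set n := Fintype.card V with hn
  set L := Real.logb 2 n
  set κ := k ^ ((1 : ℝ) / 3)
  have hL : 1 ≤ L := one_le_logb_card hd hG
  have hκ₀ : 0 < κ := by positivity
  have hκ₃ : κ ^ 3 = k := by rw [← Real.rpow_mul_natCast hk.le]; norm_num
  rcases le_or_gt 1 κ with hκ | hκ
  · calc _ ≤ ({J : Finset V | 2 * ((G.induce (J : Set V)).edgeSet.ncard : ℝ) ≤
              d * n / κ ^ 3}.ncard : ℝ) := by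
          refine Nat.cast_le.mpr (Set.ncard_le_ncard (fun J hJ => ?_) (Set.toFinite _))
          refine (two_mul_ncard_edgeSet_induce_le hJ).trans_eq ?_
          rw [hκ₃, ← hn]
          field_simp
      _ ≤ 2 ^ ((n : ℝ) / 2 * (1 + 1 / d + 2 * (L / κ ^ 2) + 4 * (L / κ))) :=
          ncard_setOf_ncard_edgeSet_induce_le hd hG hκ₀
      _ ≤ 2 ^ ((n : ℝ) / 2 * (1 + 1 / d + 2 * (L / κ) + 4 * (L / κ))) := by
          gcongr
          · exact one_le_two
          · exact le_self_pow₀ hκ two_ne_zero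
      _ = _ := by ring_nf
  · have : 1 ≤ L / κ := (one_le_div hκ₀).mpr (hκ.le.trans hL)
    calc _ ≤ (2 : ℝ) ^ (n : ℝ) := by
          rw [Real.rpow_natCast]
          exact_mod_cast (Set.ncard_le_card _).trans_eq (by simp [n])
      _ ≤ _ := by
          refine Real.rpow_le_rpow_of_exponent_le one_le_two ?_
          have : (0 : ℝ) ≤ 1 / d := by positivity
          calc (n : ℝ) = n / 2 * 2 := by ring
            _ ≤ _ := by gcongr; linarith

theorem theorem3 :
    ∃ c C₁ C₂ : ℝ, 0 < c ∧ 0 < C₁ ∧ 0 < C₂ ∧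
      ∀ (V : Type*) [Fintype V] [Nonempty V] (G : SimpleGraph V) [G.LocallyFinite] (n d : ℕ) (k : ℝ),
        Fintype.card V = n → 1 ≤ d → G.IsRegularOfDegree d →
        c * (Real.logb 2 n) ^ 9 ≤ k →
        (({J : Finset V | inducedDensity G J ≤ (1 / k) * ((d : ℝ) / (n : ℝ))}.ncard : ℕ) : ℝ) ≤
          (2 : ℝ) ^ (((n : ℝ) / 2) *
            (1 + C₁ * ((Real.logb 2 n) ^ 3 / (d : ℝ))
               + C₂ * ((Real.logb 2 n) ^ 3 / k ^ ((1 : ℝ) / 3)))) := by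
  refine ⟨1, 1, 6, one_pos, one_pos, by norm_num, ?_⟩
  rintro V _ _ G _ _ d k rfl hd hG hk
  have hL : 1 ≤ Real.logb 2 (Fintype.card V) := one_le_logb_card hd hG
  have hk₀ : 0 < k := (by positivity : 0 < 1 * Real.logb 2 (Fintype.card V) ^ 9).trans_le hk
  refine (theorem3_general hd hG hk₀).trans ?_
  rw [one_mul]
  gcongr
  · exact one_le_two
  · exact one_le_pow₀ hL
  · exact le_self_pow₀ hL three_ne_zero
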